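/- **Setting.** Let $S$, $A$ be finite, $N\ge 1$, and let $\mathcal M=(S,A,\rho,P,\gamma,\{R_j\}_{j=1}^N)$ be a multi-task MDP with initial distribution $\rho$, shared dynamics $P$, discount $\gamma\in[0,1)$ and reward functions $R_j$. For a policy $\pi$ let $d^\pi(s)=(1-\gamma)\sum_{t\ge 0}\gamma^t\Pr(s_t=s)$, and for a fixed task $i$ with $|R_i|\le R_{\max}$ let $J(\pi)=\mathbb E_\pi[\sum_{t\ge0}\gamma^t R_i(s_t,a_t)]$. For every task $j$ a dataset $\mathcal D_j$ of $n_j$ transitions $(s,a,s')$ is drawn, all draws independent, from $d^{\pi_{\beta,j}}(s)\,\pi_{\beta,j}(a|s)\,P(s'|s,a)$, where $\pi_{\beta,j}$ is the behavior policy of task $j$; write $\pi_\beta=\pi_{\beta,i}$. A *relabeling rule* $\kappa$ specifies, for each task $j\ne i$, which transitions $(s,a,s')$ of $\mathcal D_j$ are relabeled with $R_i$. It yields the effective dataset $\mathcal D_\kappa=\mathcal D_i\cup\bigcup_{j\neq i}\{x\in\mathcal D_j: \kappa\text{ relabels }x\}$ (with multiplicities). For a dataset $\mathcal D$ write $|\mathcal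 D(s,a)|$, $|\mathcal D(s)|$ for its numbers of transitions from $(s,a)$ and from $s$, $\pi_{\mathcal D}(a|s)=|\mathcal D(s,a)|/|\mathcal D(s)|$ for its behavior policy (uniform where $|\mathcal D(s)|=0$), $J_{\mathcal D}$ and $d^\pi_{\mathcal D}$ for the return and the discounted state marginal in the empirical MDP of $\mathcal D$ (initial distribution $\rho$, transition probabilities given by relative frequencies, rewards $R_i$; pairs $(s,a)$ not in $\mathcal D$ stay in $s$ with reward $0$). Let $$D_{\mathrm{CQL}}(\pi,\pi')(s)=\sum_a \pi(a|s)\Big(\frac{\pi(a|s)}{\pi'(a|s)}-1\Big)\in[0,\infty]$$ ($\infty$ if $\pi(\cdot|s)$ is not supported in the support of $\pi'(\cdot|s)$), and, for a dataset $\mathcal D$, $D(\pi,\pi')=\mathbb E_{s\sim d^\pi_{\mathcal D}}[D_{\mathrm{CQL}}(\pi,\pi')(s)]$. **Statement.** For all finite $S$, $A$, all $N$, $R_{\max}$ and $\delta\in(0,1)$ there is a constant $C>0$, depending only on $|S|,|A|,N,R_{\max},\delta$, such that for every $\mathcal M$, task $i$, behavior policies $\pi_{\beta,j}$, sample sizes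 $n_j$ and $\alpha\ge 0$ as above, with probability at least $1-\delta$ over the data the following holds. Let $\mathcal K$ be any class of relabeling rules (for instance all of them) and let $(\pi^*,\kappa^*)$, $\kappa^*\in\mathcal K$, be any joint maximizer of $$J_{\mathcal D_\kappa}(\pi)-\alpha\, D(\pi,\pi_{\mathcal D_\kappa})\qquad(\text{with } D \text{ computed on } \mathcal D_\kappa)$$ over all policies $\pi$ and all $\kappa\in\mathcal K$. Put $\mathcal D^{\mathrm{eff}}=\mathcal D_{\kappa^*}$ and $\pi^*_\beta=\pi_{\mathcal D^{\mathrm{eff}}}$, and suppose that $\mathcal D^{\mathrm{eff}}$ is distributed according to the state-action marginal of a policy, i.e. for some policy $\pi$ the expected number of copies of each $(s,a,s')$ that the rule $\kappa^*$ puts into the effective dataset is proportional to $d^{\pi}(s)\pi(a|s)P(s'|s,a)$. Then $J(\pi^*)\ge J(\pi_\beta)-\zeta$, where $$\zeta=\frac{C}{(1-\gamma)^2}\,\mathbb E_{s\sim d^{\pi^*}_{\mathcal D^{\mathrm{eff}}}}\left[\sqrt{\frac{D_{\mathrm{CQL}}(\pi^*,\pi^*_\beta)(s)+1}{|\mathcal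 D^{\mathrm{eff}}(s)|}}\right]-\Big[\alpha D(\pi^*,\pi^*_\beta)+J(\pi^*_\beta)-J(\pi_\beta)\Big]$$ ($D$ computed on $\mathcal D^{\mathrm{eff}}$, and $\zeta=\infty$ if $\pi^*$ reaches in the empirical MDP a state with $|\mathcal D^{\mathrm{eff}}(s)|=0$). -/

import Mathlib

open MeasureTheory
open scoped ENNReal NNReal

noncomputable section

namespace CDS

/-- A (stationary, stochastic) policy: `π s a` is the probability of action `a` in state `s`. -/
structure Policy (S A : Type*) [Fintype A] where
  prob : S → A → ℝ
  nonneg : ∀ s a, 0 ≤ prob s a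
  sum_eq_one : ∀ s, ∑ a, prob s a = 1

instance {S A : Type*} [Fintype A] : CoeFun (Policy S A) (fun _ => S → A → ℝ) := ⟨Policy.prob⟩

/-- A finite discounted Markov decision process. -/
structure MDP (S A : Type*) [Fintype S] where
  init : S → ℝ
  init_nonneg : ∀ s, 0 ≤ init s
  init_sum : ∑ s, init s = 1
  trans : S → A → S → ℝ
  trans_nonneg : ∀ s a s', 0 ≤ trans s a s'
  trans_sum : ∀ s a, ∑ s', trans s a s' = 1
  reward : S → A → ℝ
  γ : ℝ
  γ_nonneg : 0 ≤ γ
  γ_lt_one : γ < 1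

namespace MDP

variable {S A : Type*} [Fintype S] [Fintype A]

/-- Probability that the state at time `t` is `s` when `π` is executed in `M`. -/
def stateDist (M : MDP S A) (π : Policy S A) : ℕ → S → ℝ
  | 0 => M.init
  | t + 1 => fun s' => ∑ s, ∑ a, M.stateDist π t s * π s a * M.trans s a s'

/-- The discounted state marginal `d^π(s) = (1 - γ) ∑ₜ γᵗ Pr(sₜ = s)`. -/
def occupancy (M : MDP S A) (π : Policy S A) (s : S) : ℝ :=
  (1 - M.γ) * ∑' t : ℕ, M.γ ^ t * M.stateDist π t s

/-- The expected discounted return `J(π) = 𝔼[∑ₜ γᵗ R(sₜ, aₜ)]`. -/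
def ret (M : MDP S A) (π : Policy S A) : ℝ :=
  ∑' t : ℕ, M.γ ^ t * ∑ s, ∑ a, M.stateDist π t s * π s a * M.reward s a

end MDP

/-- A multi-task MDP: `N` reward functions, shared dynamics, initial distribution and discount. -/
structure MultiTaskMDP (S A : Type*) [Fintype S] (N : ℕ) where
  init : S → ℝ
  init_nonneg : ∀ s, 0 ≤ init s
  init_sum : ∑ s, init s = 1
  trans : S → A → S → ℝ
  trans_nonneg : ∀ s a s', 0 ≤ trans s a s'
  trans_sum : ∀ s a, ∑ s', trans s a s' = 1
  reward : Fin N → S → A → ℝ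
  γ : ℝ
  γ_nonneg : 0 ≤ γ
  γ_lt_one : γ < 1

/-- The MDP of task `i`. -/
def MultiTaskMDP.task {S A : Type*} [Fintype S] {N : ℕ} (M : MultiTaskMDP S A N) (i : Fin N) :
    MDP S A where
  init := M.init
  init_nonneg := M.init_nonneg
  init_sum := M.init_sum
  trans := M.trans
  trans_nonneg := M.trans_nonneg
  trans_sum := M.trans_sum
  reward := M.reward i
  γ := M.γ
  γ_nonneg := M.γ_nonneg
  γ_lt_one := M.γ_lt_one

section Data

variable {S A : Type*} [Fintype S] [Fintype A] [DecidableEq S] [DecidableEq A]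

/-- A dataset of transitions, as multiplicities: `c s a s'` is the number of copies of `(s, a, s')`.
(Rewards are a known function of `(s, a)`, so relabeling attaches them.) -/
abbrev Dataset (S A : Type*) := S → A → S → ℕ

/-- `|D(s, a)|`. -/
def Dataset.countSA (c : Dataset S A) (s : S) (a : A) : ℕ := ∑ s', c s a s'

/-- `|D(s)|`. -/
def Dataset.countS (c : Dataset S A) (s : S) : ℕ := ∑ a, c.countSA s a

/-- The empirical MDP induced by the transitions in the dataset `c`, the rewards of `M` being
known: transition probabilities are relative frequencies. A pair `(s, a)` that does not occur in the
dataset carries no information; by convention it yields reward `0` and stays in `s`. -/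
def empiricalMDP (M : MDP S A) (c : Dataset S A) : MDP S A where
  init := M.init
  init_nonneg := M.init_nonneg
  init_sum := M.init_sum
  trans s a s' :=
    if c.countSA s a = 0 then (if s' = s then 1 else 0) else (c s a s' : ℝ) / c.countSA s a
  trans_nonneg s a s' := by
    split_ifs <;> positivity
  trans_sum s a := by
    by_cases h : c.countSA s a = 0
    · simp [h]
    · simp only [h, if_false]
      rw [← Finset.sum_div, ← Nat.cast_sum]
      exact div_self (by exact_mod_cast h)
  reward s a := if c.countSA s a = 0 then 0 else M.reward s a
  γ := M.γ
  γ_nonneg := M.γ_nonneg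
  γ_lt_one := M.γ_lt_one

/-- The behavior policy `|D(s, a)| / |D(s)|` of a dataset (by convention uniform in states that do
not occur in it). -/
def behavior [Nonempty A] (c : Dataset S A) : Policy S A where
  prob s a := if c.countS s = 0 then 1 / (Fintype.card A : ℝ) else (c.countSA s a : ℝ) / c.countS s
  nonneg s a := by
    split_ifs <;> positivity
  sum_eq_one s := by
    by_cases h : c.countS s = 0
    · simp [h]
    · simp only [h, if_false]
      rw [← Finset.sum_div, ← Nat.cast_sum]
      exact div_self (by exact_mod_cast h)

/-- `D_CQL(p, q) = ∑ₓ p(x) (p(x) / q(x) - 1)`, which is nonnegative for probability vectors;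
it is `∞` if the support of `p` is not contained in that of `q`. -/
def dCQL (p q : A → ℝ) : ℝ≥0∞ :=
  open Classical in
  if ∀ x, q x = 0 → p x = 0 then ENNReal.ofReal (∑ x, p x * (p x / q x - 1)) else ∞

/-- `D(π, π')`: the expectation of `D_CQL(π, π')(s)` over `s ∼ d^π` in the MDP `M`. -/
def policyDiv (M : MDP S A) (π π' : Policy S A) : ℝ≥0∞ :=
  ∑ s, ENNReal.ofReal (M.occupancy π s) * dCQL (π s) (π' s)

/-- `𝔼_{s ∼ d^π_D} √((D_CQL(π, π_D)(s) + 1) / |D(s)|)`, where `π_D` is the behavior policy of the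
dataset and `d^π_D` is the state marginal of `π` in its empirical MDP; it is `∞` if `π` reaches, in
the empirical MDP, a state that does not occur in the dataset. -/
def samplingError [Nonempty A] (M : MDP S A) (c : Dataset S A) (π : Policy S A) : ℝ≥0∞ :=
  ∑ s, ENNReal.ofReal ((empiricalMDP M c).occupancy π s) *
    ((dCQL (π s) (behavior c s) + 1) / (c.countS s : ℝ≥0∞)) ^ (1 / 2 : ℝ)

/-- The objective `J_D(π) - α D(π, π_D)` for the dataset `c`. -/
def objective [Nonempty A] (M : MDP S A) (α : ℝ≥0) (c : Dataset S A) (π : Policy S A) : EReal :=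
  ((empiricalMDP M c).ret π : EReal)
    - (((α : ℝ≥0∞) * policyDiv (empiricalMDP M c) π (behavior c) : ℝ≥0∞) : EReal)

/-- Probability of drawing the transition `x = (s, a, s')` from `d^π(s) π(a|s) P(s'|s,a)`. -/
def transitionProb (M : MDP S A) (π : Policy S A) (x : S × A × S) : ℝ :=
  M.occupancy π x.1 * π x.1 x.2.1 * M.trans x.1 x.2.1 x.2.2

/-- The law `d^π(s) π(a|s) P(s'|s,a)` of a transition. -/
def transitionLaw [MeasurableSpace S] [MeasurableSpace A] (M : MDP S A) (π : Policy S A) :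
    Measure (S × A × S) :=
  ∑ x : S × A × S, ENNReal.ofReal (transitionProb M π x) • Measure.dirac x

/-- The raw multi-task data: `n j` transitions for each task `j`. -/
abbrev RawData (S A : Type*) {N : ℕ} (n : Fin N → ℕ) := (Σ j : Fin N, Fin (n j)) → S × A × S

/-- The law of the raw data: all transitions are independent, and those of task `j` are drawn from
the state-action marginal of the behavior policy `πb j` of that task. -/
def dataLaw [MeasurableSpace S] [MeasurableSpace A] {N : ℕ} (M : MultiTaskMDP S A N)
    (πb : Fin N → Policy S A) (n : Fin N → ℕ) : Measure (RawData S A n) :=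
  Measure.pi fun p => transitionLaw (M.task p.1) (πb p.1)

/-- A relabeling (data sharing) rule: transition `x` of the dataset of task `j` is relabeled and
shared iff `x ∈ κ j`. -/
abbrev Rule (S A : Type*) (N : ℕ) := Fin N → Finset (S × A × S)

/-- Under the rule `κ`, a transition `x` of task `j` enters the effective dataset of task `i`:
the data of task `i` itself is always kept. -/
def Rule.Keeps {N : ℕ} (κ : Rule S A N) (i j : Fin N) (x : S × A × S) : Prop := j = i ∨ x ∈ κ j

instance {N : ℕ} (κ : Rule S A N) (i j : Fin N) (x : S × A × S) : Decidable (κ.Keeps i j x) :=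
  inferInstanceAs (Decidable (_ ∨ _))

/-- The effective dataset of task `i`: the data of task `i` together with the transitions that `κ`
relabels from the other tasks. -/
def effDataset {N : ℕ} {n : Fin N → ℕ} (i : Fin N) (κ : Rule S A N) (ω : RawData S A n) :
    Dataset S A :=
  fun s a s' => Fintype.card {p : Σ j : Fin N, Fin (n j) // ω p = (s, a, s') ∧ κ.Keeps i p.1 (ω p)}

/-- The expected number of copies of `x` in the effective dataset of task `i` under `κ`. -/
def expectedCount {N : ℕ} (M : MultiTaskMDP S A N) (πb : Fin N → Policy S A) (n : Fin N → ℕ)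
    (i : Fin N) (κ : Rule S A N) (x : S × A × S) : ℝ :=
  ∑ j, if κ.Keeps i j x then (n j : ℝ) * transitionProb (M.task j) (πb j) x else 0

/-- The effective dataset of task `i` under `κ` is distributed according to the state-action
marginal of a policy: the expected frequencies of the transitions in it are
`d^π(s) π(a|s) P(s'|s,a)` for some policy `π`. -/
def SampledFromPolicy {N : ℕ} (M : MultiTaskMDP S A N) (πb : Fin N → Policy S A) (n : Fin N → ℕ)
    (i : Fin N) (κ : Rule S A N) : Prop :=
  ∃ π : Policy S A, ∀ x, expectedCount M πb n i κ x =
    (∑ y, expectedCount M πb n i κ y) * transitionProb (M.task i) π x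

/-- `(π, κ)` jointly maximizes the objective over all policies and over all relabeling rules in the
class `K`. (The rule determines the effective dataset and with it the effective behavior policy.) -/
def IsJointMaximizer [Nonempty A] {N : ℕ} {n : Fin N → ℕ} (M : MultiTaskMDP S A N) (α : ℝ≥0)
    (i : Fin N) (K : Set (Rule S A N)) (ω : RawData S A n) (π : Policy S A) (κ : Rule S A N) :
    Prop :=
  κ ∈ K ∧ ∀ π' : Policy S A, ∀ κ' ∈ K,
    objective (M.task i) α (effDataset i κ' ω) π' ≤ objective (M.task i) α (effDataset i κ ω) π

/-- `ζ = C / (1-γ)² · 𝔼_{s ∼ d^π_D} √((D_CQL(π, π_D)(s) + 1) / |D(s)|)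
- [α D(π, π_D) + J(π_D) - J(π_β)]`, where `π_D` is the behavior policy of the dataset `D = c`. -/
def zeta [Nonempty A] (M : MDP S A) (C : ℝ) (α : ℝ≥0) (c : Dataset S A) (π πβ : Policy S A) :
    EReal :=
  ((ENNReal.ofReal (C / (1 - M.γ) ^ 2) * samplingError M c π : ℝ≥0∞) : EReal)
    - ((((α : ℝ≥0∞) * policyDiv (empiricalMDP M c) π (behavior c) : ℝ≥0∞) : EReal)
        + ((M.ret (behavior c) - M.ret πβ : ℝ) : EReal))

end Data

end CDS

end

/-!
The benchmark in the claim is the effective behavior policy `π_D`, and `zeta` is arranged so that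
what must be shown is `J(π_D) ≤ J(π*) - α D(π*, π_D) + C / (1 - γ)² · (sampling error)`.
The penalty of `π_D` itself vanishes, so joint maximality yields the corresponding inequality
between *empirical* returns, `J_D(π_D) ≤ J_D(π*) - α D(π*, π_D)`, and it remains to bound
`|J_D - J|` at `π*` and at `π_D` by the sampling error of `π*`.

Both bounds come from one stability estimate, `MDP.abs_sum_reward_sub_ret_le`: a weighting of the
states that satisfies the flow equation of a policy up to an `ℓ¹` defect `ε` computes `(1 - γ)`
times its return up to `R ε / (1 - γ)`, since a step of the policy is an `ℓ¹`-contraction after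
discounting.

* At `π*` (`abs_empirical_ret_sub_ret_le`), the weighting is the empirical state marginal, whose
  defect in the true MDP is the error of the empirical dynamics, of order `1 / √|D(s, a)|`.
  Cauchy–Schwarz over the actions turns this into `√((D_CQL + 1) / |D(s)|)`.
* At `π_D` (`abs_ret_sub_empirical_ret_behavior_le`), the weighting is `|D(s)| / |D|`. The data being
  distributed like the marginal of a policy, its defect in the true and in the empirical MDP is a
  linear statistic of the counts with mean zero, of order `1 / √|D|`. Since `D_CQL ≥ 0` and
  `|D(s)| ≤ |D|`, the sampling error of `π*` is at least `1 / √|D|`, although it is an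
  average over the states visited by `π*` and not by `π_D`.

The only probabilistic input (`le_measure_counts_close`) is that for every relabeling rule and every
transition the effective count is within `√(K e)` of its expectation `e`: the count is a sum of
independent indicators, so its variance is at most `e`, and Chebyshev's inequality with a union bound
over the finitely many rules and transitions suffices. The union over all rules is what allows the
selected rule to depend on the data. A deviation in terms of `e` becomes one in terms of the observed
count as soon as the latter is positive (`sqrt_expectation_le`), so that rarely visited pairs need no
separate treatment.
-/

/-! ### Discounted state marginals and returns -/

namespace CDS

section Occupancy

variable {S A : Type*} [Fintype S] [Fintype A]

namespace MDP

lemma stateDist_nonneg (M : MDP S A) (π : Policy S A) (t : ℕ) (s : S) :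
    0 ≤ M.stateDist π t s := by
  induction t generalizing s with
  | zero => exact M.init_nonneg s
  | succ t ih =>
    exact Finset.sum_nonneg fun s' _ => Finset.sum_nonneg fun a _ =>
      mul_nonneg (mul_nonneg (ih s') (π.nonneg s' a)) (M.trans_nonneg s' a s)

/-- Pushing a signed mass `w` on states through one step of `π` preserves its total mass. -/
lemma sum_step (M : MDP S A) (π : Policy S A) (w : S → ℝ) :
    ∑ s', ∑ s, ∑ a, w s * π s a * M.trans s a s' = ∑ s, w s := by
  rw [Finset.sum_comm]
  refine Finset.sum_congr rfl fun s _ => ?_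
  rw [Finset.sum_comm]
  simp_rw [← Finset.mul_sum, M.trans_sum, mul_one]
  rw [← Finset.mul_sum, π.sum_eq_one, mul_one]

lemma stateDist_sum (M : MDP S A) (π : Policy S A) (t : ℕ) : ∑ s, M.stateDist π t s = 1 := by
  induction t with
  | zero => exact M.init_sum
  | succ t ih => exact (M.sum_step π _).trans ih

lemma stateDist_le_one (M : MDP S A) (π : Policy S A) (t : ℕ) (s : S) :
    M.stateDist π t s ≤ 1 := by
  rw [← M.stateDist_sum π t]
  exact Finset.single_le_sum (fun s _ => M.stateDist_nonneg π t s) (Finset.mem_univ s)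

lemma summable_discounted_stateDist (M : MDP S A) (π : Policy S A) (s : S) :
    Summable fun t : ℕ => M.γ ^ t * M.stateDist π t s := by
  refine Summable.of_nonneg_of_le
    (fun t => mul_nonneg (pow_nonneg M.γ_nonneg t) (M.stateDist_nonneg π t s)) (fun t => ?_)
    (summable_geometric_of_lt_one M.γ_nonneg M.γ_lt_one)
  exact mul_le_of_le_one_right (pow_nonneg M.γ_nonneg t) (M.stateDist_le_one π t s)

omit [Fintype A] in
lemma one_sub_γ_pos (M : MDP S A) : 0 < 1 - M.γ := sub_pos.2 M.γ_lt_one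

lemma occupancy_nonneg (M : MDP S A) (π : Policy S A) (s : S) : 0 ≤ M.occupancy π s :=
  mul_nonneg M.one_sub_γ_pos.le (tsum_nonneg fun t =>
    mul_nonneg (pow_nonneg M.γ_nonneg t) (M.stateDist_nonneg π t s))

lemma occupancy_sum (M : MDP S A) (π : Policy S A) : ∑ s, M.occupancy π s = 1 := by
  unfold occupancy
  rw [← Finset.mul_sum,
    ← Summable.tsum_finsetSum fun s _ => M.summable_discounted_stateDist π s]
  simp_rw [← Finset.mul_sum, M.stateDist_sum, mul_one]
  rw [tsum_geometric_of_lt_one M.γ_nonneg M.γ_lt_one]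
  exact mul_inv_cancel₀ M.one_sub_γ_pos.ne'

/-- The flow equation characterizing the discounted state marginal. -/
lemma occupancy_flow (M : MDP S A) (π : Policy S A) (s' : S) :
    M.occupancy π s' = (1 - M.γ) * M.init s'
      + M.γ * ∑ s, ∑ a, M.occupancy π s * π s a * M.trans s a s' := by
  have h : ∀ s a, M.occupancy π s * π s a * M.trans s a s'
      = ∑' t : ℕ, (M.γ ^ t * M.stateDist π t s) * ((1 - M.γ) * π s a * M.trans s a s') := by
    intro s a
    rw [tsum_mul_right]
    unfold occupancy
    ring
  have hs : ∀ s a, Summable fun t : ℕ =>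
      (M.γ ^ t * M.stateDist π t s) * ((1 - M.γ) * π s a * M.trans s a s') :=
    fun s a => (M.summable_discounted_stateDist π s).mul_right _
  simp_rw [h]
  rw [Finset.sum_congr rfl fun s _ => (Summable.tsum_finsetSum fun a _ => hs s a).symm,
    ← Summable.tsum_finsetSum fun s _ => summable_sum fun a _ => hs s a]
  conv_lhs => rw [occupancy, (M.summable_discounted_stateDist π s').tsum_eq_zero_add]
  rw [pow_zero, one_mul, mul_add, ← tsum_mul_left, ← tsum_mul_left]
  congr 1
  refine tsum_congr fun t => ?_
  simp only [stateDist, Finset.mul_sum]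
  refine Finset.sum_congr rfl fun s _ => Finset.sum_congr rfl fun a _ => ?_
  ring

lemma ret_eq_occupancy (M : MDP S A) (π : Policy S A) :
    (1 - M.γ) * M.ret π = ∑ s, ∑ a, M.occupancy π s * π s a * M.reward s a := by
  have h : ∀ s a, M.occupancy π s * π s a * M.reward s a
      = ∑' t : ℕ, (M.γ ^ t * M.stateDist π t s) * ((1 - M.γ) * π s a * M.reward s a) := by
    intro s a
    rw [tsum_mul_right]
    unfold occupancy
    ring
  have hs : ∀ s a, Summable fun t : ℕ =>
      (M.γ ^ t * M.stateDist π t s) * ((1 - M.γ) * π s a * M.reward s a) :=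
    fun s a => (M.summable_discounted_stateDist π s).mul_right _
  simp_rw [h]
  rw [Finset.sum_congr rfl fun s _ => (Summable.tsum_finsetSum fun a _ => hs s a).symm,
    ← Summable.tsum_finsetSum fun s _ => summable_sum fun a _ => hs s a, ret, ← tsum_mul_left]
  refine tsum_congr fun t => ?_
  simp only [Finset.mul_sum]
  refine Finset.sum_congr rfl fun s _ => Finset.sum_congr rfl fun a _ => ?_
  ring

/-- The defect of a state weighting `μ` in the flow equation of `π`: it is identically
zero exactly when `μ` is the discounted state marginal of `π`. -/
def flowDefect (M : MDP S A) (π : Policy S A) (μ : S → ℝ) (s' : S) : ℝ :=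
  μ s' - (1 - M.γ) * M.init s' - M.γ * ∑ s, ∑ a, μ s * π s a * M.trans s a s'

/-- Stability of the flow equation, from the `ℓ¹`-contraction by `γ` of a step of `π`. -/
lemma sum_abs_occupancy_sub_le (M : MDP S A) (π : Policy S A) (μ : S → ℝ) :
    (1 - M.γ) * ∑ s, |M.occupancy π s - μ s| ≤ ∑ s, |M.flowDefect π μ s| := by
  have h1 : ∀ s', |M.occupancy π s' - μ s'| ≤ |M.flowDefect π μ s'|
      + M.γ * ∑ s, ∑ a, |M.occupancy π s - μ s| * π s a * M.trans s a s' := by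
    intro s'
    have e : M.occupancy π s' - μ s' = -M.flowDefect π μ s'
        + M.γ * ∑ s, ∑ a, (M.occupancy π s - μ s) * π s a * M.trans s a s' := by
      rw [M.occupancy_flow π s', flowDefect]
      simp only [sub_mul, Finset.sum_sub_distrib]
      ring
    rw [e]
    refine (abs_add_le _ _).trans ?_
    rw [abs_neg, abs_mul, abs_of_nonneg M.γ_nonneg]
    gcongr
    · exact M.γ_nonneg
    refine (Finset.abs_sum_le_sum_abs _ _).trans (Finset.sum_le_sum fun s _ => ?_)
    refine (Finset.abs_sum_le_sum_abs _ _).trans (Finset.sum_le_sum fun a _ => ?_)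
    rw [abs_mul, abs_mul, abs_of_nonneg (π.nonneg s a), abs_of_nonneg (M.trans_nonneg s a s')]
  have h2 := Finset.sum_le_sum fun s' (_ : s' ∈ Finset.univ) => h1 s'
  rw [Finset.sum_add_distrib, ← Finset.mul_sum, M.sum_step π] at h2
  linarith

/-- A weighting that nearly satisfies the flow equation of `π` nearly computes the return. -/
lemma abs_sum_reward_sub_ret_le (M : MDP S A) (π : Policy S A) (μ : S → ℝ) {R : ℝ}
    (hR : ∀ s a, |M.reward s a| ≤ R) (hR0 : 0 ≤ R) :
    |∑ s, ∑ a, μ s * π s a * M.reward s a - (1 - M.γ) * M.ret π|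
      ≤ R / (1 - M.γ) * ∑ s, |M.flowDefect π μ s| := by
  have h1 : |∑ s, ∑ a, μ s * π s a * M.reward s a - (1 - M.γ) * M.ret π|
      ≤ ∑ s, |M.occupancy π s - μ s| * R := by
    rw [M.ret_eq_occupancy π, abs_sub_comm, ← Finset.sum_sub_distrib]
    refine (Finset.abs_sum_le_sum_abs _ _).trans (Finset.sum_le_sum fun s _ => ?_)
    rw [← Finset.sum_sub_distrib]
    refine (Finset.abs_sum_le_sum_abs _ _).trans ?_
    calc _ ≤ ∑ a, π s a * (|M.occupancy π s - μ s| * R) := by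
          refine Finset.sum_le_sum fun a _ => ?_
          rw [← sub_mul, ← sub_mul, abs_mul, abs_mul, abs_of_nonneg (π.nonneg s a)]
          have := mul_le_mul_of_nonneg_left (hR s a)
            (mul_nonneg (abs_nonneg (M.occupancy π s - μ s)) (π.nonneg s a))
          linarith
      _ = _ := by rw [← Finset.sum_mul, π.sum_eq_one, one_mul]
  rw [← Finset.sum_mul] at h1
  refine h1.trans ?_
  rw [div_mul_eq_mul_div, le_div_iff₀ M.one_sub_γ_pos]
  have := mul_le_mul_of_nonneg_left (M.sum_abs_occupancy_sub_le π μ) hR0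
  linarith

end MDP

end Occupancy

end CDS

/-! ### Concentration of the counts -/

namespace CDS

section Concentration

open ProbabilityTheory

/-- Chebyshev's inequality at the scale `√(K v)`, valid also for a vanishing variance bound `v`. -/
lemma measure_sq_dev_gt_le {Ω : Type*} [MeasurableSpace Ω] {μ : Measure Ω} [IsProbabilityMeasure μ]
    {X : Ω → ℝ} (hX : MemLp X 2 μ) {v K : ℝ} (hv : Var[X; μ] ≤ v) (hK : 0 < K) :
    μ {ω | K * v < (X ω - μ[X]) ^ 2} ≤ ENNReal.ofReal (1 / K) := by
  rcases (variance_nonneg X μ |>.trans hv).eq_or_lt with rfl | hpos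
  · have h0 : evariance X μ = 0 := by
      rw [← hX.ofReal_variance_eq, ENNReal.ofReal_eq_zero]
      exact hv
    rw [evariance_eq_zero_iff hX.aemeasurable] at h0
    have : μ {ω | K * 0 < (X ω - μ[X]) ^ 2} = 0 := by
      refine measure_mono_null (fun ω hω => ?_) (ae_iff.1 h0)
      intro h
      simp [h] at hω
    rw [this]
    exact zero_le
  · have hc : 0 < √(K * v) := Real.sqrt_pos.2 (mul_pos hK hpos)
    refine (measure_mono fun ω hω => ?_).trans
      ((meas_ge_le_variance_div_sq hX hc).trans (ENNReal.ofReal_le_ofReal ?_))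
    · rw [Set.mem_ofPred_eq, ← Real.sqrt_sq_eq_abs]
      exact Real.sqrt_le_sqrt (le_of_lt hω)
    · rw [Real.sq_sqrt (mul_pos hK hpos).le, div_le_div_iff₀ (mul_pos hK hpos) hK]
      nlinarith

variable {S A : Type*} [Fintype S] [Fintype A] [DecidableEq S] [DecidableEq A]

omit [DecidableEq S] [DecidableEq A] in
lemma transitionProb_nonneg (M : MDP S A) (π : Policy S A) (x : S × A × S) :
    0 ≤ transitionProb M π x :=
  mul_nonneg (mul_nonneg (M.occupancy_nonneg π _) (π.nonneg _ _)) (M.trans_nonneg _ _ _)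

omit [DecidableEq S] [DecidableEq A] in
lemma transitionProb_sum (M : MDP S A) (π : Policy S A) : ∑ x, transitionProb M π x = 1 := by
  simp only [transitionProb, Fintype.sum_prod_type, ← Finset.mul_sum, M.trans_sum, mul_one,
    π.sum_eq_one, M.occupancy_sum]

variable [MeasurableSpace S] [DiscreteMeasurableSpace S] [MeasurableSpace A]
  [DiscreteMeasurableSpace A]

omit [DecidableEq S] [DecidableEq A] [DiscreteMeasurableSpace S] [DiscreteMeasurableSpace A] in
lemma isProbabilityMeasure_transitionLaw (M : MDP S A) (π : Policy S A) :
    IsProbabilityMeasure (transitionLaw M π) := by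
  constructor
  simp only [transitionLaw, Measure.finsetSum_apply, Measure.smul_apply, measure_univ, smul_eq_mul,
    mul_one]
  rw [← ENNReal.ofReal_sum_of_nonneg fun x _ => transitionProb_nonneg M π x, transitionProb_sum,
    ENNReal.ofReal_one]

omit [DecidableEq S] [DecidableEq A] [DiscreteMeasurableSpace S] [DiscreteMeasurableSpace A] in
lemma isProbabilityMeasure_dataLaw {N : ℕ} (M : MultiTaskMDP S A N) (πb : Fin N → Policy S A)
    (n : Fin N → ℕ) : IsProbabilityMeasure (dataLaw M πb n) := by
  have : ∀ p : Σ j : Fin N, Fin (n j),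
      IsProbabilityMeasure (transitionLaw (M.task p.1) (πb p.1)) :=
    fun p => isProbabilityMeasure_transitionLaw _ _
  unfold dataLaw
  infer_instance

omit [DecidableEq S] [DecidableEq A] in
lemma integral_transitionLaw (M : MDP S A) (π : Policy S A) (f : S × A × S → ℝ) :
    ∫ x, f x ∂transitionLaw M π = ∑ x, transitionProb M π x * f x := by
  unfold transitionLaw
  rw [integral_finsetSum_measure fun x _ => (integrable_dirac (by simp)).smul_measure (by simp)]
  refine Finset.sum_congr rfl fun x _ => ?_
  rw [integral_smul_measure, integral_dirac, ENNReal.toReal_ofReal (transitionProb_nonneg M π x),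
    smul_eq_mul]

/-- The number of copies of a transition in the effective dataset, as a function of the raw data,
deviates from its expectation by at most the order of the square root of that expectation: it is a
sum of independent indicators, so its variance is at most its mean. -/
lemma measure_sq_count_dev_gt_le {N : ℕ} (M : MultiTaskMDP S A N) (πb : Fin N → Policy S A)
    (n : Fin N → ℕ) (i : Fin N) (κ : Rule S A N) (x : S × A × S) {K : ℝ} (hK : 0 < K) :
    dataLaw M πb n {ω | K * expectedCount M πb n i κ x
        < ((effDataset i κ ω x.1 x.2.1 x.2.2 : ℝ) - expectedCount M πb n i κ x) ^ 2}
      ≤ ENNReal.ofReal (1 / K) := by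
  have hP : ∀ p : Σ j : Fin N, Fin (n j),
      IsProbabilityMeasure (transitionLaw (M.task p.1) (πb p.1)) :=
    fun p => isProbabilityMeasure_transitionLaw _ _
  have := isProbabilityMeasure_dataLaw M πb n
  let Y : (Σ j : Fin N, Fin (n j)) → S × A × S → ℝ :=
    fun p y => if y = x ∧ κ.Keeps i p.1 y then 1 else 0
  have hYm : ∀ p, MemLp (Y p) 2 (transitionLaw (M.task p.1) (πb p.1)) := fun p => MemLp.of_discrete
  have hYint : ∀ p, ∫ y, Y p y ∂transitionLaw (M.task p.1) (πb p.1)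
      = if κ.Keeps i p.1 x then transitionProb (M.task p.1) (πb p.1) x else 0 := by
    intro p
    rw [integral_transitionLaw, Finset.sum_eq_single x]
    · simp [Y]
    · intro y _ hy
      simp [Y, hy]
    · simp
  have hsum : ∑ p : Σ j : Fin N, Fin (n j),
      (if κ.Keeps i p.1 x then transitionProb (M.task p.1) (πb p.1) x else 0)
      = expectedCount M πb n i κ x := by
    rw [Fintype.sum_sigma]
    refine Finset.sum_congr rfl fun j _ => ?_
    simp
  have hZ : ∀ ω : RawData S A n, (effDataset i κ ω x.1 x.2.1 x.2.2 : ℝ)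
      = (∑ p, fun ω : RawData S A n => Y p (ω p)) ω := by
    intro ω
    simp only [effDataset, Fintype.card_subtype, Finset.sum_apply, Y, Finset.sum_boole]
  have hmean : ∫ ω, (∑ p, fun ω : RawData S A n => Y p (ω p)) ω ∂dataLaw M πb n
      = expectedCount M πb n i κ x := by
    simp only [Finset.sum_apply]
    rw [integral_finsetSum _ fun p _ => Integrable.of_finite, ← hsum]
    refine Finset.sum_congr rfl fun p _ => ?_
    rw [← hYint p]
    exact integral_comp_eval (hYm p).1
  have hvar : Var[∑ p, fun ω : RawData S A n => Y p (ω p); dataLaw M πb n]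
      ≤ expectedCount M πb n i κ x := by
    unfold dataLaw
    rw [variance_sum_pi hYm, ← hsum]
    refine Finset.sum_le_sum fun p _ => ?_
    rw [← hYint p]
    refine (variance_le_expectation_sq (hYm p).1).trans_eq (integral_congr_ae (ae_of_all _ ?_))
    intro y
    simp [Y]
  have := measure_sq_dev_gt_le (μ := dataLaw M πb n)
    (X := ∑ p, fun ω : RawData S A n => Y p (ω p)) MemLp.of_discrete hvar hK
  rw [hmean] at this
  simpa only [hZ] using this

/-- With probability at least `1 - δ`, the counts in the effective datasets of all relabeling rules
are simultaneously close to their expectations. -/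
lemma le_measure_counts_close {N : ℕ} (M : MultiTaskMDP S A N) (πb : Fin N → Policy S A)
    (n : Fin N → ℕ) (i : Fin N) {δ : ℝ} (hδ : 0 < δ) {K : ℝ} (hK : 0 < K)
    (hKδ : (Fintype.card (Rule S A N × (S × A × S)) : ℝ) / K ≤ δ) :
    ENNReal.ofReal (1 - δ) ≤ dataLaw M πb n {ω | ∀ κ x,
      ((effDataset i κ ω x.1 x.2.1 x.2.2 : ℝ) - expectedCount M πb n i κ x) ^ 2
        ≤ K * expectedCount M πb n i κ x} := by
  have := isProbabilityMeasure_dataLaw M πb n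
  rw [← compl_compl {ω : RawData S A n | _}, prob_compl_eq_one_sub (MeasurableSet.of_discrete),
    ENNReal.ofReal_sub _ hδ.le, ENNReal.ofReal_one]
  refine tsub_le_tsub_left ?_ _
  have hsub : {ω : RawData S A n | ∀ κ x,
      ((effDataset i κ ω x.1 x.2.1 x.2.2 : ℝ) - expectedCount M πb n i κ x) ^ 2
        ≤ K * expectedCount M πb n i κ x}ᶜ ⊆ ⋃ q : Rule S A N × (S × A × S),
      {ω | K * expectedCount M πb n i q.1 q.2 < ((effDataset i q.1 ω q.2.1 q.2.2.1 q.2.2.2 : ℝ)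
        - expectedCount M πb n i q.1 q.2) ^ 2} := by
    intro ω hω
    simp only [Set.mem_compl_iff, Set.mem_ofPred_eq, not_forall, not_le] at hω
    obtain ⟨κ, x, h⟩ := hω
    exact Set.mem_iUnion.2 ⟨(κ, x), h⟩
  refine (measure_mono hsub).trans ((measure_iUnion_fintype_le _ _).trans ?_)
  refine (Finset.sum_le_sum fun q _ => measure_sq_count_dev_gt_le M πb n i q.1 q.2 hK).trans ?_
  rw [Finset.sum_const, nsmul_eq_mul, Finset.card_univ, ← ENNReal.ofReal_natCast,
    ← ENNReal.ofReal_mul (by positivity)]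
  exact ENNReal.ofReal_le_ofReal (by rwa [mul_one_div])

end Concentration

end CDS

/-! ### Empirical dynamics and state frequencies -/

namespace CDS

section Counts

/-- A count `c ≥ 1` within `L √e` of its expectation `e` bounds `e`, however small `e` is. -/
lemma sqrt_expectation_le {L c e : ℝ} (hL : 0 ≤ L) (hc : 1 ≤ c) (he : 0 ≤ e)
    (h : |c - e| ≤ L * √e) : √e ≤ (L + 1) * √c := by
  have h1 : √e ^ 2 ≤ √c ^ 2 + L * √e := by
    rw [Real.sq_sqrt he, Real.sq_sqrt (by linarith)]
    linarith [(abs_le.1 h).1]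
  have hz : 1 ≤ √c := Real.one_le_sqrt.2 hc
  by_contra! hlt
  have h2 : √c ≤ √e - L := by nlinarith
  have h3 : √c < √e := by nlinarith
  nlinarith

/-- Square-root closeness of all counts passes to the total deviation over a set of outcomes that
occurs at least once, with the observed rather than the expected number of occurrences. -/
lemma sum_abs_dev_le {X : Type*} [Fintype X] {f : X → ℕ} {e : X → ℝ} {K : ℝ}
    (hK : 0 ≤ K) (he : ∀ x, 0 ≤ e x) (h : ∀ x, ((f x : ℝ) - e x) ^ 2 ≤ K * e x) (T : Finset X)
    (hT : 1 ≤ ∑ x ∈ T, (f x : ℝ)) :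
    ∑ x ∈ T, |(f x : ℝ) - e x| ≤ (Fintype.card X * √K) * (Fintype.card X * √K + 1)
      * √(∑ x ∈ T, (f x : ℝ)) := by
  set L : ℝ := Fintype.card X * √K
  have hL : 0 ≤ L := by positivity
  have h1 : ∑ x ∈ T, |(f x : ℝ) - e x| ≤ L * √(∑ x ∈ T, e x) := by
    have h2 : ∀ x ∈ T, |(f x : ℝ) - e x| ≤ √K * √(∑ x ∈ T, e x) := by
      intro x hx
      rw [← Real.sqrt_mul' _ (Finset.sum_nonneg fun x _ => he x)]
      refine Real.abs_le_sqrt ((h x).trans ?_)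
      exact mul_le_mul_of_nonneg_left (Finset.single_le_sum (fun x _ => he x) hx) hK
    refine (Finset.sum_le_sum h2).trans ?_
    rw [Finset.sum_const, nsmul_eq_mul, ← mul_assoc]
    have hT' : (T.card : ℝ) ≤ Fintype.card X := by exact_mod_cast Finset.card_le_univ T
    exact mul_le_mul_of_nonneg_right
      (mul_le_mul_of_nonneg_right hT' (Real.sqrt_nonneg _)) (Real.sqrt_nonneg _)
  have h2 : |∑ x ∈ T, (f x : ℝ) - ∑ x ∈ T, e x| ≤ L * √(∑ x ∈ T, e x) := by
    rw [← Finset.sum_sub_distrib]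
    exact (Finset.abs_sum_le_sum_abs _ _).trans h1
  have h3 := sqrt_expectation_le hL hT (Finset.sum_nonneg fun x _ => he x) h2
  calc _ ≤ L * √(∑ x ∈ T, e x) := h1
    _ ≤ L * ((L + 1) * √(∑ x ∈ T, (f x : ℝ))) := by gcongr
    _ = _ := by ring

variable {S A : Type*} [Fintype S] [Fintype A]

omit [Fintype A] in
lemma Dataset.cast_countSA (c : Dataset S A) (s : S) (a : A) :
    (c.countSA s a : ℝ) = ∑ s', (c s a s' : ℝ) := by
  simp [Dataset.countSA]

lemma Dataset.cast_countS (c : Dataset S A) (s : S) :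
    (c.countS s : ℝ) = ∑ a, (c.countSA s a : ℝ) := by
  simp [Dataset.countS]

/-- The number of transitions in a dataset. -/
def Dataset.size (c : Dataset S A) : ℕ := ∑ s, c.countS s

lemma Dataset.cast_size (c : Dataset S A) : (c.size : ℝ) = ∑ s, (c.countS s : ℝ) := by
  simp [Dataset.size]

lemma Dataset.cast_size_eq_sum (c : Dataset S A) :
    (c.size : ℝ) = ∑ x : S × A × S, (c x.1 x.2.1 x.2.2 : ℝ) := by
  simp only [Dataset.cast_size, Dataset.cast_countS, Dataset.cast_countSA, Fintype.sum_prod_type]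

lemma Dataset.countS_le_size (c : Dataset S A) (s : S) : c.countS s ≤ c.size :=
  Finset.single_le_sum (f := c.countS) (fun _ _ => Nat.zero_le _) (Finset.mem_univ s)

lemma Dataset.countSA_le_countS (c : Dataset S A) (s : S) (a : A) : c.countSA s a ≤ c.countS s :=
  Finset.single_le_sum (f := c.countSA s) (fun _ _ => Nat.zero_le _) (Finset.mem_univ a)

lemma countS_mul_behavior [Nonempty A] (c : Dataset S A) (s : S) (a : A) :
    (c.countS s : ℝ) * behavior c s a = c.countSA s a := by
  by_cases h : c.countS s = 0
  · have := c.countSA_le_countS s a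
    have h' : c.countSA s a = 0 := by omega
    simp [h, h']
  · have : (c.countS s : ℝ) ≠ 0 := by exact_mod_cast h
    simp only [behavior, h, if_false]
    field_simp

variable [DecidableEq S]

omit [Fintype A] in
lemma countSA_mul_empirical_trans (M : MDP S A) (c : Dataset S A) (s : S) (a : A) (s' : S) :
    (c.countSA s a : ℝ) * (empiricalMDP M c).trans s a s' = c s a s' := by
  by_cases h : c.countSA s a = 0
  · have h' : c s a s' = 0 := by
      have : c s a s' ≤ c.countSA s a :=
        Finset.single_le_sum (f := c s a) (fun _ _ => Nat.zero_le _) (Finset.mem_univ s')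
      omega
    simp [h, h']
  · have : (c.countSA s a : ℝ) ≠ 0 := by exact_mod_cast h
    simp only [empiricalMDP, h, if_false]
    field_simp

omit [Fintype A] in
lemma countSA_mul_empirical_reward (M : MDP S A) (c : Dataset S A) (s : S) (a : A) :
    (c.countSA s a : ℝ) * (empiricalMDP M c).reward s a = c.countSA s a * M.reward s a := by
  by_cases h : c.countSA s a = 0
  · simp [h]
  · simp [empiricalMDP, h]

/-- If expected transition counts factor through the true dynamics, then the empirical transition
probabilities are accurate to the order of the inverse square root of the number of visits. -/
lemma sum_abs_empirical_trans_sub_le (M : MDP S A) (c : Dataset S A) {e : S × A × S → ℝ} {K : ℝ}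
    (hK : 0 ≤ K) (he : ∀ x, 0 ≤ e x) (h : ∀ x, ((c x.1 x.2.1 x.2.2 : ℝ) - e x) ^ 2 ≤ K * e x)
    (hdyn : ∀ s a s', e (s, a, s') = (∑ s'', e (s, a, s'')) * M.trans s a s')
    (s : S) (a : A) (hc : c.countSA s a ≠ 0) :
    ∑ s', |(empiricalMDP M c).trans s a s' - M.trans s a s'|
      ≤ 2 * ((Fintype.card (S × A × S) * √K) * (Fintype.card (S × A × S) * √K + 1))
        / √(c.countSA s a) := by
  set B : ℝ := (Fintype.card (S × A × S) * √K) * (Fintype.card (S × A × S) * √K + 1)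
  have hpos : (0 : ℝ) < c.countSA s a := by exact_mod_cast Nat.pos_of_ne_zero hc
  have hT : ∀ g : S × A × S → ℝ,
      ∑ x ∈ ({s} ×ˢ ({a} ×ˢ Finset.univ) : Finset (S × A × S)), g x = ∑ s', g (s, a, s') := by
    intro g
    simp
  have hdev := sum_abs_dev_le (f := fun x : S × A × S => c x.1 x.2.1 x.2.2) hK he h
    ({s} ×ˢ ({a} ×ˢ Finset.univ)) (by
      rw [hT, ← Dataset.cast_countSA]
      exact_mod_cast Nat.pos_of_ne_zero hc)
  rw [hT, hT, ← Dataset.cast_countSA] at hdev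
  have key : ∀ s', (c.countSA s a : ℝ) * |(empiricalMDP M c).trans s a s' - M.trans s a s'|
      ≤ |(c s a s' : ℝ) - e (s, a, s')|
        + (∑ s'', |(c s a s'' : ℝ) - e (s, a, s'')|) * M.trans s a s' := by
    intro s'
    rw [← abs_of_pos hpos, ← abs_mul, mul_sub, countSA_mul_empirical_trans]
    have e1 : (c s a s' : ℝ) - c.countSA s a * M.trans s a s' = ((c s a s' : ℝ) - e (s, a, s'))
        - (∑ s'', ((c s a s'' : ℝ) - e (s, a, s''))) * M.trans s a s' := by
      rw [Finset.sum_sub_distrib, ← Dataset.cast_countSA, sub_mul, ← hdyn]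
      ring
    rw [e1]
    refine (abs_sub _ _).trans ?_
    rw [abs_mul, abs_of_nonneg (M.trans_nonneg s a s')]
    gcongr
    · exact M.trans_nonneg s a s'
    · exact Finset.abs_sum_le_sum_abs _ _
  have hsum := Finset.sum_le_sum fun s' (_ : s' ∈ Finset.univ) => key s'
  rw [← Finset.mul_sum, Finset.sum_add_distrib, ← Finset.mul_sum, M.trans_sum, mul_one] at hsum
  rw [le_div_iff₀ (Real.sqrt_pos.2 hpos)]
  have h2 : √(c.countSA s a : ℝ) * √(c.countSA s a : ℝ) = c.countSA s a :=
    Real.mul_self_sqrt hpos.le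
  have h3 := Real.sqrt_pos.2 hpos
  refine le_of_mul_le_mul_right ?_ h3
  calc _ = (c.countSA s a : ℝ) * ∑ s', |(empiricalMDP M c).trans s a s' - M.trans s a s'| := by
        rw [mul_assoc, h2, mul_comm]
    _ ≤ _ := by linarith

/-- The relative frequency `|D(s)| / |D|` of a state in a dataset. -/
noncomputable def stateFreq (c : Dataset S A) (s : S) : ℝ := (c.countS s : ℝ) / c.size

omit [DecidableEq S] in
lemma stateFreq_mul_behavior [Nonempty A] (c : Dataset S A) (s : S) (a : A) :
    stateFreq c s * behavior c s a = (c.countSA s a : ℝ) / c.size := by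
  rw [stateFreq, div_mul_eq_mul_div, countS_mul_behavior]

omit [DecidableEq S] in
/-- If the expected counts `e` satisfy a flow equation, then the observed state frequencies nearly
satisfy the flow equation of the behavior policy, in any MDP whose dynamics transport the observed
state-action counts approximately to the expected arrivals. -/
lemma size_mul_sum_abs_flowDefect_le [Nonempty A] (M : MDP S A) (c : Dataset S A)
    {e : S × A × S → ℝ} {B : ℝ}
    (hflow : ∀ s', ∑ a, ∑ s'', e (s', a, s'')
      = (1 - M.γ) * M.init s' * (∑ x, e x) + M.γ * ∑ s, ∑ a, e (s, a, s'))
    (hB : ∑ x, |(c x.1 x.2.1 x.2.2 : ℝ) - e x| ≤ B)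
    (htr : ∑ s', |∑ s, ∑ a, ((c.countSA s a : ℝ) * M.trans s a s' - e (s, a, s'))| ≤ B)
    (hc : c.size ≠ 0) :
    (c.size : ℝ) * ∑ s, |M.flowDefect (behavior c) (stateFreq c) s| ≤ 2 * B := by
  have hpos : (0 : ℝ) < c.size := by exact_mod_cast Nat.pos_of_ne_zero hc
  have key : ∀ s', (c.size : ℝ) * |M.flowDefect (behavior c) (stateFreq c) s'|
      ≤ ∑ a, ∑ s'', |(c s' a s'' : ℝ) - e (s', a, s'')| + (1 - M.γ) * M.init s' * B
        + M.γ * |∑ s, ∑ a, ((c.countSA s a : ℝ) * M.trans s a s' - e (s, a, s'))| := by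
    intro s'
    rw [← abs_of_pos hpos, ← abs_mul]
    have e1 : (c.size : ℝ) * M.flowDefect (behavior c) (stateFreq c) s'
        = ∑ a, ∑ s'', ((c s' a s'' : ℝ) - e (s', a, s''))
          - (1 - M.γ) * M.init s' * (∑ x : S × A × S, ((c x.1 x.2.1 x.2.2 : ℝ) - e x))
          - M.γ * ∑ s, ∑ a, ((c.countSA s a : ℝ) * M.trans s a s' - e (s, a, s')) := by
      have e2 : (c.size : ℝ) * ∑ s, ∑ a, stateFreq c s * behavior c s a * M.trans s a s'
          = ∑ s, ∑ a, (c.countSA s a : ℝ) * M.trans s a s' := by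
        simp only [stateFreq_mul_behavior, Finset.mul_sum]
        refine Finset.sum_congr rfl fun s _ => Finset.sum_congr rfl fun a _ => ?_
        field_simp
      have e3 : (c.size : ℝ) * stateFreq c s' = ∑ a, ∑ s'', (c s' a s'' : ℝ) := by
        simp only [← Dataset.cast_countSA, ← Dataset.cast_countS, stateFreq]
        field_simp
      simp only [Finset.sum_sub_distrib, ← Dataset.cast_size_eq_sum]
      rw [MDP.flowDefect, mul_sub, mul_sub, e3, hflow,
        show (c.size : ℝ) * (M.γ * ∑ s, ∑ a, stateFreq c s * behavior c s a * M.trans s a s')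
          = M.γ * ∑ s, ∑ a, (c.countSA s a : ℝ) * M.trans s a s' by rw [← e2]; ring]
      ring
    rw [e1]
    refine (abs_sub _ _).trans (add_le_add ((abs_sub _ _).trans (add_le_add ?_ ?_)) ?_)
    · exact (Finset.abs_sum_le_sum_abs _ _).trans
        (Finset.sum_le_sum fun a _ => Finset.abs_sum_le_sum_abs _ _)
    · have h0 : 0 ≤ (1 - M.γ) * M.init s' := mul_nonneg M.one_sub_γ_pos.le (M.init_nonneg s')
      rw [abs_mul, abs_of_nonneg h0]
      exact mul_le_mul_of_nonneg_left ((Finset.abs_sum_le_sum_abs _ _).trans hB) h0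
    · rw [abs_mul, abs_of_nonneg M.γ_nonneg]
  have hsum := Finset.sum_le_sum fun s' (_ : s' ∈ Finset.univ) => key s'
  rw [← Finset.mul_sum, Finset.sum_add_distrib, Finset.sum_add_distrib, ← Finset.mul_sum,
    ← Finset.sum_mul, ← Finset.mul_sum, M.init_sum] at hsum
  have hB' : ∑ s', ∑ a, ∑ s'', |(c s' a s'' : ℝ) - e (s', a, s'')| ≤ B := by
    simpa only [Fintype.sum_prod_type] using hB
  have := mul_le_mul_of_nonneg_left htr M.γ_nonneg
  linarith

/-- The returns of the behavior policy of a dataset in the true and in the empirical MDP are close if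
the data are distributed like the state-action marginal of a policy: both are close to the average
reward in the data, divided by `1 - γ`. -/
lemma abs_ret_sub_empirical_ret_behavior_le [Nonempty A] (M : MDP S A) (c : Dataset S A)
    {e : S × A × S → ℝ} {K R : ℝ} (hR : ∀ s a, |M.reward s a| ≤ R) (hR0 : 0 ≤ R)
    (hK : 0 ≤ K) (he : ∀ x, 0 ≤ e x) (h : ∀ x, ((c x.1 x.2.1 x.2.2 : ℝ) - e x) ^ 2 ≤ K * e x)
    (hdyn : ∀ s a s', e (s, a, s') = (∑ s'', e (s, a, s'')) * M.trans s a s')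
    (hflow : ∀ s', ∑ a, ∑ s'', e (s', a, s'')
      = (1 - M.γ) * M.init s' * (∑ x, e x) + M.γ * ∑ s, ∑ a, e (s, a, s'))
    (hc : c.size ≠ 0) :
    |M.ret (behavior c) - (empiricalMDP M c).ret (behavior c)|
      ≤ 4 * R * ((Fintype.card (S × A × S) * √K) * (Fintype.card (S × A × S) * √K + 1))
        / (1 - M.γ) ^ 2 * (1 / √c.size) := by
  set B₀ : ℝ := (Fintype.card (S × A × S) * √K) * (Fintype.card (S × A × S) * √K + 1)
  have hpos : (0 : ℝ) < c.size := by exact_mod_cast Nat.pos_of_ne_zero hc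
  have hB : ∑ x, |(c x.1 x.2.1 x.2.2 : ℝ) - e x| ≤ B₀ * √c.size := by
    have := sum_abs_dev_le (f := fun x : S × A × S => c x.1 x.2.1 x.2.2) hK he h Finset.univ (by
      rw [← Dataset.cast_size_eq_sum]
      exact_mod_cast Nat.pos_of_ne_zero hc)
    rwa [← Dataset.cast_size_eq_sum] at this
  have hBe := hB
  simp only [Fintype.sum_prod_type] at hBe
  have htrue : ∑ s', |∑ s, ∑ a, ((c.countSA s a : ℝ) * M.trans s a s' - e (s, a, s'))|
      ≤ B₀ * √c.size := by
    refine le_trans ?_ hBe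
    calc _ ≤ ∑ s', ∑ s, ∑ a, (∑ s'', |(c s a s'' : ℝ) - e (s, a, s'')|) * M.trans s a s' := by
          refine Finset.sum_le_sum fun s' _ => ?_
          refine (Finset.abs_sum_le_sum_abs _ _).trans (Finset.sum_le_sum fun s _ => ?_)
          refine (Finset.abs_sum_le_sum_abs _ _).trans (Finset.sum_le_sum fun a _ => ?_)
          rw [hdyn s a s', Dataset.cast_countSA, ← sub_mul, ← Finset.sum_sub_distrib, abs_mul,
            abs_of_nonneg (M.trans_nonneg s a s')]
          exact mul_le_mul_of_nonneg_right (Finset.abs_sum_le_sum_abs _ _) (M.trans_nonneg s a s')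
      _ = _ := by
          rw [Finset.sum_comm]
          refine Finset.sum_congr rfl fun s _ => ?_
          rw [Finset.sum_comm]
          refine Finset.sum_congr rfl fun a _ => ?_
          rw [← Finset.mul_sum, M.trans_sum, mul_one]
  have hemp : ∑ s', |∑ s, ∑ a, ((c.countSA s a : ℝ) * (empiricalMDP M c).trans s a s'
      - e (s, a, s'))| ≤ B₀ * √c.size := by
    refine le_trans ?_ hBe
    simp only [countSA_mul_empirical_trans]
    calc _ ≤ ∑ s', ∑ s, ∑ a, |(c s a s' : ℝ) - e (s, a, s')| := by
          refine Finset.sum_le_sum fun s' _ => ?_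
          refine (Finset.abs_sum_le_sum_abs _ _).trans (Finset.sum_le_sum fun s _ => ?_)
          exact Finset.abs_sum_le_sum_abs _ _
      _ = _ := by
          rw [Finset.sum_comm]
          exact Finset.sum_congr rfl fun s _ => Finset.sum_comm
  have hRe : ∀ s a, |(empiricalMDP M c).reward s a| ≤ R := by
    intro s a
    simp only [empiricalMDP]
    split_ifs
    · simpa using hR0
    · exact hR s a
  have h1 := size_mul_sum_abs_flowDefect_le M c hflow hB htrue hc
  have h2 := size_mul_sum_abs_flowDefect_le (empiricalMDP M c) c hflow hB hemp hc
  have h3 := M.abs_sum_reward_sub_ret_le (behavior c) (stateFreq c) hR hR0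
  have h4 := (empiricalMDP M c).abs_sum_reward_sub_ret_le (behavior c) (stateFreq c) hRe hR0
  have hrew : ∑ s, ∑ a, stateFreq c s * behavior c s a * (empiricalMDP M c).reward s a
      = ∑ s, ∑ a, stateFreq c s * behavior c s a * M.reward s a := by
    refine Finset.sum_congr rfl fun s _ => Finset.sum_congr rfl fun a _ => ?_
    rw [stateFreq_mul_behavior, div_mul_eq_mul_div, div_mul_eq_mul_div,
      countSA_mul_empirical_reward]
  rw [hrew] at h4
  change |_ - (1 - M.γ) * _| ≤ R / (1 - M.γ) * _ at h4
  have hγ := M.one_sub_γ_pos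
  set q := ∑ s, ∑ a, stateFreq c s * behavior c s a * M.reward s a
  set d1 := ∑ s, |M.flowDefect (behavior c) (stateFreq c) s|
  set d2 := ∑ s, |(empiricalMDP M c).flowDefect (behavior c) (stateFreq c) s|
  have hsz : B₀ * √c.size / c.size = B₀ * (1 / √c.size) := by
    rw [mul_div_assoc, Real.sqrt_div_self', one_div]
  have hd : ∀ d : ℝ, (c.size : ℝ) * d ≤ 2 * (B₀ * √c.size) → d ≤ 2 * (B₀ * (1 / √c.size)) := by
    intro d hd
    rw [← hsz, ← mul_div_assoc, le_div_iff₀ hpos]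
    linarith
  have h5 : (1 - M.γ) * |M.ret (behavior c) - (empiricalMDP M c).ret (behavior c)|
      ≤ R / (1 - M.γ) * (4 * (B₀ * (1 / √c.size))) := by
    rw [← abs_of_pos hγ, ← abs_mul, abs_of_pos hγ]
    have hR' : 0 ≤ R / (1 - M.γ) := by positivity
    have h6 := mul_le_mul_of_nonneg_left (hd _ h1) hR'
    have h7 := mul_le_mul_of_nonneg_left (hd _ h2) hR'
    have h8 := abs_le.1 h3
    have h9 := abs_le.1 h4
    rw [abs_le]
    constructor <;> linarith [h8.1, h8.2, h9.1, h9.2]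
  refine le_of_mul_le_mul_left (h5.trans_eq ?_) hγ
  field_simp

end Counts

end CDS

/-! ### The CQL divergence and the sampling error -/

namespace CDS

section Divergence

variable {A : Type*} [Fintype A]

lemma dCQL_self (q : A → ℝ) : dCQL q q = 0 := by
  simp only [dCQL]
  rw [if_pos fun x hx => hx]
  rw [ENNReal.ofReal_eq_zero]
  refine Finset.sum_nonpos fun x _ => ?_
  rcases eq_or_ne (q x) 0 with h | h
  · simp [h]
  · simp [h]

lemma dCQL_ne_top_iff {p q : A → ℝ} : dCQL p q ≠ ∞ ↔ ∀ x, q x = 0 → p x = 0 := by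
  simp only [dCQL]
  split_ifs with h
  · simpa using h
  · simp [h]

/-- `D_CQL(p, q) + 1` is the second moment `∑ p² / q`. -/
lemma dCQL_add_one {p q : A → ℝ} (hq0 : ∀ x, 0 ≤ q x) (hp : ∑ x, p x = 1) (hq : ∑ x, q x = 1)
    (h : ∀ x, q x = 0 → p x = 0) : dCQL p q + 1 = ENNReal.ofReal (∑ x, p x ^ 2 / q x) := by
  have e : ∑ x, p x * (p x / q x - 1) = ∑ x, p x ^ 2 / q x - 1 := by
    simp only [mul_sub, mul_one, Finset.sum_sub_distrib, hp]
    congr 1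
    exact Finset.sum_congr rfl fun x _ => by ring
  have h0 : 0 ≤ ∑ x, p x ^ 2 / q x - 1 := by
    have : ∀ x, p x * 2 - q x ≤ p x ^ 2 / q x := by
      intro x
      rcases (hq0 x).eq_or_lt with h0 | h0
      · simp [← h0, h x h0.symm]
      · rw [le_div_iff₀ h0]
        nlinarith [sq_nonneg (p x - q x)]
    have := Finset.sum_le_sum fun x (_ : x ∈ Finset.univ) => this x
    rw [Finset.sum_sub_distrib, ← Finset.sum_mul, hp, hq] at this
    linarith
  simp only [dCQL]
  rw [if_pos h, e, ← ENNReal.ofReal_one, ← ENNReal.ofReal_add h0 zero_le_one, sub_add_cancel]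

/-- By Cauchy–Schwarz, the expected inverse square root of the number of visits to the actions is
controlled by the second moment `∑ p² / q`, where `q` is the vector of relative frequencies. -/
lemma sum_mul_inv_sqrt_le {p q : A → ℝ} (hq0 : ∀ x, 0 ≤ q x) (n : ℝ) (hn : 0 ≤ n) :
    ∑ x, p x * (1 / √(n * q x)) ≤ √(Fintype.card A) * √((∑ x, p x ^ 2 / q x) / n) := by
  rw [← Real.sqrt_mul (Nat.cast_nonneg _)]
  refine Real.le_sqrt_of_sq_le (sq_sum_le_card_mul_sum_sq.trans_eq ?_)
  rw [Finset.card_univ, Finset.sum_div]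
  congr 1
  refine Finset.sum_congr rfl fun x _ => ?_
  rw [mul_pow, div_pow, Real.sq_sqrt (mul_nonneg hn (hq0 x)), one_pow, mul_one_div, div_div,
    mul_comm n]

variable {S : Type*} [Fintype S] [DecidableEq S] [Nonempty A]

/-- The `s`-th contribution to the sampling error, as a real number: the second moment form of
`√((D_CQL(π, π_D)(s) + 1) / |D(s)|)`. It agrees with the latter only where the latter is finite:
division by zero makes it finite also where `|D(s)| = 0` or the support condition fails. -/
noncomputable def localError (c : Dataset S A) (π : Policy S A) (s : S) : ℝ :=
  √((∑ a, π s a ^ 2 / behavior c s a) / c.countS s)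

lemma support_of_samplingError_ne_top {M : MDP S A} {c : Dataset S A} {π : Policy S A}
    (h : samplingError M c π ≠ ∞) {s : S} (hs : (empiricalMDP M c).occupancy π s ≠ 0) :
    c.countS s ≠ 0 ∧ ∀ a, behavior c s a = 0 → π s a = 0 := by
  have hterm := (ENNReal.sum_ne_top.1 h) s (Finset.mem_univ s)
  have hocc : ENNReal.ofReal ((empiricalMDP M c).occupancy π s) ≠ 0 := by
    rw [Ne, ENNReal.ofReal_eq_zero, not_le]
    exact lt_of_le_of_ne ((empiricalMDP M c).occupancy_nonneg π s) hs.symm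
  have hpow : ((dCQL (π s) (behavior c s) + 1) / (c.countS s : ℝ≥0∞)) ^ (1 / 2 : ℝ) ≠ ∞ := by
    intro htop
    rw [htop, ENNReal.mul_top hocc] at hterm
    exact hterm rfl
  have hdiv : (dCQL (π s) (behavior c s) + 1) / (c.countS s : ℝ≥0∞) ≠ ∞ := by
    intro htop
    rw [htop, ENNReal.top_rpow_of_pos (by norm_num)] at hpow
    exact hpow rfl
  constructor
  · intro h0
    rw [h0, Nat.cast_zero, ENNReal.div_zero (by simp)] at hdiv
    exact hdiv rfl
  · rw [← dCQL_ne_top_iff]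
    intro htop
    rw [htop, top_add, ENNReal.top_div_of_ne_top (by simp)] at hdiv
    exact hdiv rfl

lemma samplingError_eq {M : MDP S A} {c : Dataset S A} {π : Policy S A}
    (h : samplingError M c π ≠ ∞) : samplingError M c π
      = ENNReal.ofReal (∑ s, (empiricalMDP M c).occupancy π s * localError c π s) := by
  rw [ENNReal.ofReal_sum_of_nonneg fun s _ => show
    0 ≤ (empiricalMDP M c).occupancy π s * localError c π s from
    mul_nonneg ((empiricalMDP M c).occupancy_nonneg π s) (Real.sqrt_nonneg _)]
  refine Finset.sum_congr rfl fun s _ => ?_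
  rcases eq_or_ne ((empiricalMDP M c).occupancy π s) 0 with h0 | h0
  · simp [h0]
  · obtain ⟨hc, hsupp⟩ := support_of_samplingError_ne_top h h0
    have hpos : (0 : ℝ) < c.countS s := by exact_mod_cast Nat.pos_of_ne_zero hc
    have hm : 0 ≤ ∑ a, π s a ^ 2 / behavior c s a :=
      Finset.sum_nonneg fun a _ => div_nonneg (sq_nonneg _) ((behavior c).nonneg s a)
    rw [ENNReal.ofReal_mul ((empiricalMDP M c).occupancy_nonneg π s),
      dCQL_add_one ((behavior c).nonneg s) (π.sum_eq_one s) ((behavior c).sum_eq_one s) hsupp,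
      ← ENNReal.ofReal_natCast, ← ENNReal.ofReal_div_of_pos hpos,
      ENNReal.ofReal_rpow_of_nonneg (div_nonneg hm hpos.le) (by norm_num), ← Real.sqrt_eq_rpow]
    rfl

lemma size_ne_zero_of_samplingError_ne_top {M : MDP S A} {c : Dataset S A} {π : Policy S A}
    (h : samplingError M c π ≠ ∞) : c.size ≠ 0 := by
  have hsum := (empiricalMDP M c).occupancy_sum π
  obtain ⟨s, -, hs⟩ := Finset.exists_ne_zero_of_sum_ne_zero (hsum.trans_ne one_ne_zero)
  have h1 := (support_of_samplingError_ne_top h hs).1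
  have h2 := c.countS_le_size s
  omega

/-- The sampling error is at least `1 / √|D|`, because `D_CQL` is nonnegative. -/
lemma inv_sqrt_size_le {M : MDP S A} {c : Dataset S A} {π : Policy S A}
    (h : samplingError M c π ≠ ∞) :
    1 / √c.size ≤ ∑ s, (empiricalMDP M c).occupancy π s * localError c π s := by
  have hterm : ∀ s, (empiricalMDP M c).occupancy π s * (1 / √c.size)
      ≤ (empiricalMDP M c).occupancy π s * localError c π s := by
    intro s
    rcases eq_or_ne ((empiricalMDP M c).occupancy π s) 0 with h0 | h0
    · simp [h0]
    refine mul_le_mul_of_nonneg_left ?_ ((empiricalMDP M c).occupancy_nonneg π s)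
    obtain ⟨hc, hsupp⟩ := support_of_samplingError_ne_top h h0
    have hpos : (0 : ℝ) < c.countS s := by exact_mod_cast Nat.pos_of_ne_zero hc
    have hle : (c.countS s : ℝ) ≤ c.size := by exact_mod_cast c.countS_le_size s
    have h1 : 1 ≤ ∑ a, π s a ^ 2 / behavior c s a := by
      have := dCQL_add_one ((behavior c).nonneg s) (π.sum_eq_one s) ((behavior c).sum_eq_one s)
        hsupp
      rw [← ENNReal.one_le_ofReal, ← this]
      exact le_add_self
    rw [localError, ← Real.sqrt_one, ← Real.sqrt_div zero_le_one]
    gcongr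
  have := Finset.sum_le_sum fun s (_ : s ∈ Finset.univ) => hterm s
  rwa [← Finset.sum_mul, (empiricalMDP M c).occupancy_sum, one_mul] at this

/-- Simulation lemma: if the empirical transition probabilities are accurate to the order of the
inverse square root of the number of visits, then the return of any policy in the empirical MDP is
accurate to the order of its sampling error. -/
lemma abs_empirical_ret_sub_ret_le {M : MDP S A} {c : Dataset S A} {π : Policy S A} {B R : ℝ}
    (hR : ∀ s a, |M.reward s a| ≤ R) (hR0 : 0 ≤ R) (hB : 0 ≤ B)
    (htr : ∀ s a, c.countSA s a ≠ 0 →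
      ∑ s', |(empiricalMDP M c).trans s a s' - M.trans s a s'| ≤ B / √(c.countSA s a))
    (h : samplingError M c π ≠ ∞) :
    |(empiricalMDP M c).ret π - M.ret π| ≤ √(Fintype.card A) * R * B / (1 - M.γ) ^ 2
      * ∑ s, (empiricalMDP M c).occupancy π s * localError c π s := by
  set d := (empiricalMDP M c).occupancy π with hd
  have hd0 : ∀ s, 0 ≤ d s := (empiricalMDP M c).occupancy_nonneg π
  have hγ := M.one_sub_γ_pos
  -- only pairs that occur in the data carry mass under the empirical marginal of `π`
  have hvis : ∀ s a, d s * π s a ≠ 0 → c.countSA s a ≠ 0 := by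
    intro s a hne h0
    obtain ⟨hc, hsupp⟩ := support_of_samplingError_ne_top h (left_ne_zero_of_mul hne)
    refine right_ne_zero_of_mul hne (hsupp a ?_)
    simp [behavior, hc, h0]
  have hrew : (1 - M.γ) * (empiricalMDP M c).ret π = ∑ s, ∑ a, d s * π s a * M.reward s a := by
    refine ((empiricalMDP M c).ret_eq_occupancy π).trans ?_
    refine Finset.sum_congr rfl fun s _ => Finset.sum_congr rfl fun a _ => ?_
    rcases eq_or_ne (d s * π s a) 0 with h0 | h0
    · rw [← hd, h0, zero_mul, zero_mul]
    · rw [← hd]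
      congr 1
      exact if_neg (hvis s a h0)
  have h1 := M.abs_sum_reward_sub_ret_le π d hR hR0
  rw [← hrew] at h1
  have hdef : ∀ s', M.flowDefect π d s'
      = M.γ * ∑ s, ∑ a, d s * π s a * ((empiricalMDP M c).trans s a s' - M.trans s a s') := by
    intro s'
    have e1 : d s' = (1 - M.γ) * M.init s'
        + M.γ * ∑ s, ∑ a, d s * π s a * (empiricalMDP M c).trans s a s' :=
      (empiricalMDP M c).occupancy_flow π s'
    rw [MDP.flowDefect, e1]
    simp only [mul_sub, Finset.sum_sub_distrib]
    ring
  have h2 : ∑ s', |M.flowDefect π d s'| ≤ ∑ s, ∑ a, d s * π s a * (B / √(c.countSA s a)) := by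
    calc _ ≤ ∑ s', ∑ s, ∑ a,
          d s * π s a * |(empiricalMDP M c).trans s a s' - M.trans s a s'| := by
          refine Finset.sum_le_sum fun s' _ => ?_
          rw [hdef, abs_mul, abs_of_nonneg M.γ_nonneg]
          refine (mul_le_of_le_one_left (abs_nonneg _) M.γ_lt_one.le).trans ?_
          refine (Finset.abs_sum_le_sum_abs _ _).trans (Finset.sum_le_sum fun s _ => ?_)
          refine (Finset.abs_sum_le_sum_abs _ _).trans (Finset.sum_le_sum fun a _ => ?_)
          rw [abs_mul, abs_of_nonneg (mul_nonneg (hd0 s) (π.nonneg s a))]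
      _ = ∑ s, ∑ a, d s * π s a
          * ∑ s', |(empiricalMDP M c).trans s a s' - M.trans s a s'| := by
          rw [Finset.sum_comm]
          refine Finset.sum_congr rfl fun s _ => ?_
          rw [Finset.sum_comm]
          simp only [Finset.mul_sum]
      _ ≤ _ := by
          refine Finset.sum_le_sum fun s _ => Finset.sum_le_sum fun a _ => ?_
          rcases eq_or_ne (d s * π s a) 0 with h0 | h0
          · rw [h0, zero_mul, zero_mul]
          · exact mul_le_mul_of_nonneg_left (htr s a (hvis s a h0))
              (mul_nonneg (hd0 s) (π.nonneg s a))
  have h3 : ∑ s, ∑ a, d s * π s a * (B / √(c.countSA s a))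
      ≤ √(Fintype.card A) * B * ∑ s, d s * localError c π s := by
    rw [Finset.mul_sum]
    refine Finset.sum_le_sum fun s _ => ?_
    have h4 := sum_mul_inv_sqrt_le (p := π s) ((behavior c).nonneg s) (c.countS s)
      (Nat.cast_nonneg _)
    simp only [countS_mul_behavior] at h4
    calc _ = d s * B * ∑ a, π s a * (1 / √(c.countSA s a)) := by
          rw [Finset.mul_sum]
          exact Finset.sum_congr rfl fun a _ => by ring
      _ ≤ d s * B * (√(Fintype.card A) * localError c π s) :=
          mul_le_mul_of_nonneg_left h4 (mul_nonneg (hd0 s) hB)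
      _ = _ := by ring
  have h5 : (1 - M.γ) * |(empiricalMDP M c).ret π - M.ret π|
      ≤ R / (1 - M.γ) * (√(Fintype.card A) * B * ∑ s, d s * localError c π s) := by
    rw [← abs_of_pos hγ, ← abs_mul, mul_sub, abs_of_pos hγ]
    exact h1.trans (mul_le_mul_of_nonneg_left (h2.trans h3) (by positivity))
  refine le_of_mul_le_mul_left (h5.trans_eq ?_) hγ
  field_simp

end Divergence

end CDS

/-! ### Comparison of the returns -/

namespace CDS

section Guarantee

variable {S A : Type*} [Fintype S] [Fintype A] [DecidableEq S] [DecidableEq A]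

lemma expectedCount_nonneg {N : ℕ} (M : MultiTaskMDP S A N) (πb : Fin N → Policy S A)
    (n : Fin N → ℕ) (i : Fin N) (κ : Rule S A N) (x : S × A × S) :
    0 ≤ expectedCount M πb n i κ x := by
  refine Finset.sum_nonneg fun j _ => ?_
  split_ifs
  · exact mul_nonneg (Nat.cast_nonneg _) (transitionProb_nonneg _ _ _)
  · exact le_rfl

/-- A relabeling rule may filter on the successor state and thereby bias the empirical dynamics;
it does not do so if the effective dataset is distributed like the marginal of a policy. -/
lemma SampledFromPolicy.expectedCount_eq_mul_trans {N : ℕ} {M : MultiTaskMDP S A N}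
    {πb : Fin N → Policy S A} {n : Fin N → ℕ} {i : Fin N} {κ : Rule S A N}
    (h : SampledFromPolicy M πb n i κ) (s : S) (a : A) (s' : S) :
    expectedCount M πb n i κ (s, a, s')
      = (∑ s'', expectedCount M πb n i κ (s, a, s'')) * (M.task i).trans s a s' := by
  obtain ⟨π, hπ⟩ := h
  have hsum : ∑ s'', expectedCount M πb n i κ (s, a, s'')
      = (∑ y, expectedCount M πb n i κ y) * ((M.task i).occupancy π s * π s a) := by
    rw [Finset.sum_congr rfl fun s'' _ => hπ (s, a, s''), ← Finset.mul_sum]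
    simp only [transitionProb]
    rw [← Finset.mul_sum, (M.task i).trans_sum, mul_one]
  rw [hsum, hπ]
  simp only [transitionProb]
  ring

lemma SampledFromPolicy.expectedCount_flow {N : ℕ} {M : MultiTaskMDP S A N}
    {πb : Fin N → Policy S A} {n : Fin N → ℕ} {i : Fin N} {κ : Rule S A N}
    (h : SampledFromPolicy M πb n i κ) (s' : S) :
    ∑ a, ∑ s'', expectedCount M πb n i κ (s', a, s'')
      = (1 - (M.task i).γ) * (M.task i).init s' * (∑ x, expectedCount M πb n i κ x)
        + (M.task i).γ * ∑ s, ∑ a, expectedCount M πb n i κ (s, a, s') := by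
  obtain ⟨π, hπ⟩ := h
  set m := ∑ x, expectedCount M πb n i κ x
  have h1 : ∑ a, ∑ s'', expectedCount M πb n i κ (s', a, s'')
      = m * (M.task i).occupancy π s' := by
    simp only [hπ, transitionProb, ← Finset.mul_sum, (M.task i).trans_sum, mul_one, π.sum_eq_one]
  have h2 : ∑ s, ∑ a, expectedCount M πb n i κ (s, a, s')
      = m * ∑ s, ∑ a, (M.task i).occupancy π s * π s a * (M.task i).trans s a s' := by
    simp only [hπ, transitionProb, ← Finset.mul_sum]
  rw [h1, h2, (M.task i).occupancy_flow π s']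
  ring

omit [DecidableEq A] in
/-- The objective of the behavior policy carries no penalty. -/
lemma objective_behavior [Nonempty A] (M : MDP S A) (α : ℝ≥0) (c : Dataset S A) :
    objective M α c (behavior c) = ((empiricalMDP M c).ret (behavior c) : EReal) := by
  simp [objective, policyDiv, dCQL_self]

omit [DecidableEq A] in
/-- The comparison of returns in `EReal`, given that the penalized policy beats the behavior policy
on the data and that both empirical returns are accurate. -/
lemma ret_sub_zeta_le [Nonempty A] {M : MDP S A} {C : ℝ} (hC : 0 < C) {α : ℝ≥0} {c : Dataset S A}
    {π πβ : Policy S A}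
    (hmax : ((empiricalMDP M c).ret (behavior c) : EReal) ≤ objective M α c π)
    (hsim : samplingError M c π ≠ ∞ →
      |(empiricalMDP M c).ret π - M.ret π|
          + |M.ret (behavior c) - (empiricalMDP M c).ret (behavior c)|
        ≤ C / (1 - M.γ) ^ 2 * ∑ s, (empiricalMDP M c).occupancy π s * localError c π s) :
    ((M.ret πβ : ℝ) : EReal) - zeta M C α c π πβ ≤ ((M.ret π : ℝ) : EReal) := by
  have hCγ : 0 < C / (1 - M.γ) ^ 2 := div_pos hC (pow_pos M.one_sub_γ_pos 2)
  unfold objective at hmax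
  unfold zeta
  -- maximality excludes an infinite penalty, so that no `⊤ - ⊤` occurs in `zeta`
  have hY : (α : ℝ≥0∞) * policyDiv (empiricalMDP M c) π (behavior c) ≠ ∞ := by
    intro htop
    rw [htop] at hmax
    simp at hmax
  set Y := (α : ℝ≥0∞) * policyDiv (empiricalMDP M c) π (behavior c)
  obtain ⟨y, hy0, hy⟩ : ∃ y : ℝ, 0 ≤ y ∧ Y = ENNReal.ofReal y :=
    ⟨Y.toReal, ENNReal.toReal_nonneg, (ENNReal.ofReal_toReal hY).symm⟩
  have hyE : (Y : EReal) = (y : EReal) := by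
    rw [hy, EReal.coe_ennreal_ofReal, max_eq_left hy0]
  rw [hyE] at hmax ⊢
  rcases eq_or_ne (samplingError M c π) ∞ with htop | hfin
  · rw [htop, ENNReal.mul_top (by simpa using hCγ), EReal.coe_ennreal_top, ← EReal.coe_add,
      EReal.top_sub_coe, sub_eq_add_neg, EReal.neg_top, EReal.add_bot]
    exact bot_le
  · have hs := hsim hfin
    have h0 : 0 ≤ ∑ s, (empiricalMDP M c).occupancy π s * localError c π s :=
      Finset.sum_nonneg fun s _ =>
        mul_nonneg ((empiricalMDP M c).occupancy_nonneg π s) (Real.sqrt_nonneg _)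
    rw [samplingError_eq hfin, ← ENNReal.ofReal_mul hCγ.le, EReal.coe_ennreal_ofReal,
      max_eq_left (mul_nonneg hCγ.le h0)]
    norm_cast at hmax ⊢
    have h1 := le_abs_self ((empiricalMDP M c).ret π - M.ret π)
    have h2 := le_abs_self (M.ret (behavior c) - (empiricalMDP M c).ret (behavior c))
    linarith

end Guarantee

end CDS

theorem proposition1 {S A : Type*} [Fintype S] [Fintype A] [DecidableEq S] [DecidableEq A]
    [Nonempty A] [MeasurableSpace S] [DiscreteMeasurableSpace S]
    [MeasurableSpace A] [DiscreteMeasurableSpace A]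
    (N : ℕ) (Rmax : ℝ) (δ : ℝ) (hδ : 0 < δ) (hδ1 : δ < 1) :
    ∃ C : ℝ, 0 < C ∧
      ∀ (M : CDS.MultiTaskMDP S A N) (i : Fin N) (_ : ∀ s a, |M.reward i s a| ≤ Rmax)
        (πb : Fin N → CDS.Policy S A) (n : Fin N → ℕ) (α : ℝ≥0),
        ENNReal.ofReal (1 - δ) ≤ CDS.dataLaw M πb n
          {ω | ∀ (K : Set (CDS.Rule S A N)) (πstar : CDS.Policy S A) (κstar : CDS.Rule S A N),
            CDS.IsJointMaximizer M α i K ω πstar κstar →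
            CDS.SampledFromPolicy M πb n i κstar →
            (((M.task i).ret (πb i) : ℝ) : EReal)
                - CDS.zeta (M.task i) C α (CDS.effDataset i κstar ω) πstar (πb i)
              ≤ (((M.task i).ret πstar : ℝ) : EReal)} := by
  -- the `+ 1` keeps `k` positive when there are no transitions at all
  set k : ℝ := (Fintype.card (CDS.Rule S A N × (S × A × S)) + 1) / δ
  have hk : 0 < k := by positivity
  set B : ℝ := (Fintype.card (S × A × S) * √k) * (Fintype.card (S × A × S) * √k + 1)
  have hB : 0 ≤ B := by positivity
  have hR0 : 0 ≤ |Rmax| := abs_nonneg _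
  have hC : 0 < √(Fintype.card A) * |Rmax| * (2 * B) + 4 * |Rmax| * B + 1 := by positivity
  refine ⟨_, hC, fun M i hM πb n α => ?_⟩
  have hR : ∀ s a, |(M.task i).reward s a| ≤ |Rmax| := fun s a => (hM s a).trans (le_abs_self _)
  refine (CDS.le_measure_counts_close M πb n i hδ hk ?_).trans (measure_mono ?_)
  · rw [div_div_eq_mul_div, div_le_iff₀ (by positivity)]
    nlinarith
  intro ω hω K π κ hmax hs
  have hclose := hω κ
  have he := CDS.expectedCount_nonneg M πb n i κ
  set c := CDS.effDataset i κ ω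
  refine CDS.ret_sub_zeta_le hC ?_ fun hfin => ?_
  · rw [← CDS.objective_behavior (M.task i) α c]
    exact hmax.2 (CDS.behavior c) κ hmax.1
  · have h1 := CDS.abs_empirical_ret_sub_ret_le hR hR0 (by positivity : 0 ≤ 2 * B)
      (CDS.sum_abs_empirical_trans_sub_le (M.task i) c hk.le he hclose
        hs.expectedCount_eq_mul_trans) hfin
    have h2 := CDS.abs_ret_sub_empirical_ret_behavior_le (M.task i) c hR hR0 hk.le he hclose
      hs.expectedCount_eq_mul_trans hs.expectedCount_flow
      (CDS.size_ne_zero_of_samplingError_ne_top hfin)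
    have h3 := CDS.inv_sqrt_size_le hfin
    have hγ := (M.task i).one_sub_γ_pos
    set E := ∑ s, (CDS.empiricalMDP (M.task i) c).occupancy π s * CDS.localError c π s
    have hE : 0 ≤ E := le_trans (by positivity) h3
    have h4 := h2.trans (mul_le_mul_of_nonneg_left h3 (by positivity))
    refine (add_le_add h1 h4).trans ?_
    rw [← add_mul, ← add_div]
    exact mul_le_mul_of_nonneg_right
      (div_le_div_of_nonneg_right (le_add_of_nonneg_right zero_le_one) (by positivity)) hE
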